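/- Let $X, Y$ be finite sets and $f : X \times Y \to \{0,1\}$; $\log$ is the base-2 logarithm. Let $Q_{\mathrm{oip}}(f)$ be the minimum number of queries made by a quantum algorithm which, for every $x \in X$, given access to the oracle $|y\rangle|a\rangle \mapsto |y\rangle|a \oplus f(x,y)\rangle$, outputs $x$ with probability at least $2/3$ ($Q_{\mathrm{oip}}(f)=\infty$ if there is no such algorithm). Let $Q_{\mathrm{cc}}(f)$ be the minimum total number of qubits exchanged (in both directions) in a two-party protocol in which Alice holds $x \in X$, Bob holds $y \in Y$, the players use a two-way qubit channel and may share an arbitrary finite-dimensional entangled state independent of the inputs, and Bob outputs $f(x,y)$ with probability at least $2/3$ on every input. **Theorem.** There is an absolute constant $C$ such that for every finite set $X$ and every positive integer $q \le \log |X|$ there exist a finite set $Y$ and a function $f : X \times Y \to \{0,1\}$ such that $Q_{\mathrm{oip}}(f)$ and $Q_{\mathrm{cc}}(f)$ are finite, $q/2 \le Q_{\mathrm{oip}}(f) \le q$, and $$Q_{\mathrm{oip}}(f) \cdot Q_{\mathrm{cc}}(f) \;\le\; \tfrac12 \log |X| + C\cdot\bigl(Q_{\mathrm{oip}}(f) \log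 Q_{\mathrm{oip}}(f) + 1\bigr).$$ -/

import Mathlib

open scoped Matrix

namespace QTradeoff

universe u v

/-- A quantum algorithm making `T` oracle queries that outputs an element of `X`. The state space is
`ℂ^Y ⊗ ℂ^(ZMod m) ⊗ ℂ^W` with an arbitrary finite workspace `W`; the algorithm starts in a fixed
basis state, alternates input-independent unitaries `U 0, …, U T` with queries, and finally measures
in the computational basis and reads its answer off the outcome. -/
structure QueryAlgorithm (X : Type u) (Y : Type v) [Fintype Y] [DecidableEq Y]
    (m : ℕ) [NeZero m] (T : ℕ) where
  W : Type
  [fintypeW : Fintype W]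
  [decEqW : DecidableEq W]
  start : Y × ZMod m × W
  U : Fin (T + 1) → Matrix.unitaryGroup (Y × ZMod m × W) ℂ
  out : Y × ZMod m × W → X

attribute [instance] QueryAlgorithm.fintypeW QueryAlgorithm.decEqW

/-- One query: the unitary `|y⟩|a⟩|w⟩ ↦ |y⟩|a + g y⟩|w⟩`, acting on amplitude vectors. -/
def query {Y : Type v} {m : ℕ} {W : Type} (g : Y → ZMod m) (ψ : Y × ZMod m × W → ℂ) :
    Y × ZMod m × W → ℂ :=
  fun s => ψ (s.1, s.2.1 - g s.1, s.2.2)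

namespace QueryAlgorithm

variable {X : Type u} {Y : Type v} [Fintype Y] [DecidableEq Y] {m : ℕ} [NeZero m] {T : ℕ}

/-- The state after `t` queries to the oracle for `g`, each followed by its unitary. -/
noncomputable def state (alg : QueryAlgorithm X Y m T) (g : Y → ZMod m) :
    (t : ℕ) → t < T + 1 → Y × ZMod m × alg.W → ℂ
  | 0, h => (alg.U ⟨0, h⟩ : Matrix _ _ ℂ) *ᵥ Pi.single alg.start 1
  | t + 1, h =>
      (alg.U ⟨t + 1, h⟩ : Matrix _ _ ℂ) *ᵥ query g (alg.state g t (Nat.lt_of_succ_lt h))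

open Classical in
/-- The probability that the algorithm, run with the oracle for `g`, outputs `x`. -/
noncomputable def outputProb (alg : QueryAlgorithm X Y m T) (g : Y → ZMod m) (x : X) : ℝ :=
  ∑ s, if alg.out s = x then ‖alg.state g T (Nat.lt_succ_self T) s‖ ^ 2 else 0

end QueryAlgorithm

/-- Quantum query complexity of identifying `x` from the oracle for `f x`, with failure probability
at most `ε` for every `x`; it is `⊤` when no such algorithm exists. -/
noncomputable def Qoip {X : Type u} {Y : Type v} [Fintype Y] [DecidableEq Y]
    {m : ℕ} [NeZero m] (ε : ℝ) (f : X → Y → ZMod m) : ℕ∞ :=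
  sInf {c : ℕ∞ | ∃ (T : ℕ) (alg : QueryAlgorithm X Y m T),
    (∀ x, 1 - ε ≤ alg.outputProb (f x) x) ∧ (T : ℕ∞) = c}

/-- The computational basis labels of `k` qubits. -/
abbrev Qubits (k : ℕ) : Type := Fin k → Bool

/-- Two-way qubit-channel protocols, seen from a moment at which Alice holds a register with basis
`A` and Bob one with basis `B`. Local operations are isometries, that is, unitaries that may use
fresh ancillas in a fixed state; they depend on the input of the acting player only.
* `aliceSends`: Alice applies `U x : ℂ^A → ℂ^A' ⊗ (ℂ²)^⊗k` and sends the `k` qubits to Bob;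
* `bobSends`: Bob applies `V y : ℂ^B → ℂ^B' ⊗ (ℂ²)^⊗k` and sends the `k` qubits to Alice;
* `output`: Bob applies `V y : ℂ^B → ℂ^(ZMod m) ⊗ ℂ^B'` and measures the output register. -/
inductive CommProtocol (X : Type u) (Y : Type v) (m : ℕ) [NeZero m] :
    (A B : Type) → [Fintype A] → [DecidableEq A] → [Fintype B] → [DecidableEq B] →
      Type (max 1 u v)
  | output {A B : Type} [Fintype A] [DecidableEq A] [Fintype B] [DecidableEq B]
      (B' : Type) [Fintype B'] [DecidableEq B']
      (V : Y → Matrix (ZMod m × B') B ℂ) (hV : ∀ y, (V y)ᴴ * V y = 1) :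
      CommProtocol X Y m A B
  | aliceSends {A B : Type} [Fintype A] [DecidableEq A] [Fintype B] [DecidableEq B]
      (k : ℕ) (A' : Type) [Fintype A'] [DecidableEq A']
      (U : X → Matrix (A' × Qubits k) A ℂ) (hU : ∀ x, (U x)ᴴ * U x = 1)
      (next : CommProtocol X Y m A' (B × Qubits k)) :
      CommProtocol X Y m A B
  | bobSends {A B : Type} [Fintype A] [DecidableEq A] [Fintype B] [DecidableEq B]
      (k : ℕ) (B' : Type) [Fintype B'] [DecidableEq B']
      (V : Y → Matrix (B' × Qubits k) B ℂ) (hV : ∀ y, (V y)ᴴ * V y = 1)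
      (next : CommProtocol X Y m (A × Qubits k) B') :
      CommProtocol X Y m A B

namespace CommProtocol

variable {X : Type u} {Y : Type v} {m : ℕ} [NeZero m]

/-- The total number of qubits exchanged, in both directions. -/
def cost {A B : Type} [Fintype A] [DecidableEq A] [Fintype B] [DecidableEq B] :
    CommProtocol X Y m A B → ℕ
  | output _ _ _ => 0
  | aliceSends k _ _ _ next => k + next.cost
  | bobSends k _ _ _ next => k + next.cost

/-- The probability that Bob's measurement yields `z` on inputs `x`, `y`, when the protocol starts
in the joint state with amplitudes `ψ`. -/
noncomputable def outputProb {A B : Type} [Fintype A] [DecidableEq A] [Fintype B] [DecidableEq B] :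
    CommProtocol X Y m A B → X → Y → (A × B → ℂ) → ZMod m → ℝ
  | output B' V _, _, y, ψ, z =>
      ∑ a : A, ∑ b' : B', ‖(V y *ᵥ fun b => ψ (a, b)) (z, b')‖ ^ 2
  | aliceSends _ _ U _ next, x, y, ψ, z =>
      next.outputProb x y (fun s => (U x *ᵥ fun a => ψ (a, s.2.1)) (s.1, s.2.2)) z
  | bobSends _ _ V _ next, x, y, ψ, z =>
      next.outputProb x y (fun s => (V y *ᵥ fun b => ψ (s.1.1, b)) (s.2, s.1.2)) z

end CommProtocol

/-- Entanglement-assisted two-way qubit-channel communication complexity of `f` with failure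
probability at most `ε` on every input: the players may share any finite-dimensional pure state `φ`
that does not depend on the inputs. -/
noncomputable def Qcc {X : Type u} {Y : Type v} {m : ℕ} [NeZero m]
    (ε : ℝ) (f : X → Y → ZMod m) : ℕ∞ :=
  sInf {c : ℕ∞ | ∃ (A B : Type) (_ : Fintype A) (_ : DecidableEq A) (_ : Fintype B)
    (_ : DecidableEq B) (P : CommProtocol X Y m A B) (φ : A × B → ℂ),
    ∑ s, ‖φ s‖ ^ 2 = 1 ∧ (∀ x y, 1 - ε ≤ P.outputProb x y φ (f x y)) ∧ (P.cost : ℕ∞) = c}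

end QTradeoff

set_option linter.unusedSectionVars false

/-! Let n = log |X| and k = ⌈n/(2q)⌉. Encode x injectively as q blocks of 2k bits, and let f(x, (i,
y)) be the inner product modulo 2 of the i-th block with y.

One Bernstein–Vazirani query reads a whole block, so q queries identify x with certainty
(`Qoip_blockDot_le`). For communication, Bob names his block with `Nat.clog 2 q` qubits and Alice
returns its 2k bits in k qubits by superdense coding (`Qcc_blockDot_le`); this halving gives the
factor 1/2 in front of log |X|.

Since 2^q ≤ |X|, the encoding can be chosen so that its image contains a q-dimensional cube, with
one free bit per block. On that cube a query reads at most one bit, so after T queries the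
amplitudes have Fourier degree at most T. If 2T < q, such functions span at most half of all
functions on the cube, and the average success probability is at most 1/2
(`card_le_two_mul_queries`). Hence q ≤ 2Q, where Q is the query complexity, and the rounding
overhead q log q + 2q is O(Q log Q + 1). -/

namespace QTradeoff

/-! ### Walsh characters of the cube. -/

section Characters

variable {ι : Type*} [Fintype ι]

/-- The nontrivial additive character of `ZMod 2`. -/
def sgn (a : ZMod 2) : ℂ := if a = 0 then 1 else -1

lemma zmod_two_eq_zero_or_one (a : ZMod 2) : a = 0 ∨ a = 1 := by
  revert a; decide

@[simp] lemma sgn_zero : sgn 0 = 1 := by simp [sgn]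

@[simp] lemma sgn_one : sgn 1 = -1 := by simp [sgn]

lemma sgn_add (a b : ZMod 2) : sgn (a + b) = sgn a * sgn b := by
  have h : (1 + 1 : ZMod 2) = 0 := by decide
  rcases zmod_two_eq_zero_or_one a with rfl | rfl <;>
    rcases zmod_two_eq_zero_or_one b with rfl | rfl <;> simp [h]

lemma sgn_sub (a b : ZMod 2) : sgn (a - b) = sgn a * sgn b := by
  rw [sub_eq_add_neg, ZMod.neg_eq_self_mod_two, sgn_add]

@[simp] lemma star_sgn (a : ZMod 2) : star (sgn a) = sgn a := by
  rcases zmod_two_eq_zero_or_one a with rfl | rfl <;> simp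

lemma sgn_mul_self (a : ZMod 2) : sgn a * sgn a = 1 := by
  rcases zmod_two_eq_zero_or_one a with rfl | rfl <;> simp

lemma sgn_sum {κ : Type*} (s : Finset κ) (g : κ → ZMod 2) :
    sgn (∑ i ∈ s, g i) = ∏ i ∈ s, sgn (g i) := by
  classical
  induction s using Finset.induction_on with
  | empty => simp
  | insert a s ha ih => rw [Finset.sum_insert ha, Finset.prod_insert ha, sgn_add, ih]

lemma sum_sgn_mul (a b : ZMod 2) :
    ∑ c : ZMod 2, sgn (a * c) * sgn (c * b) = if a = b then 2 else 0 := by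
  have h : (Finset.univ : Finset (ZMod 2)) = {0, 1} := by decide
  rw [h, Finset.sum_pair (by decide)]
  rcases zmod_two_eq_zero_or_one a with rfl | rfl <;>
    rcases zmod_two_eq_zero_or_one b with rfl | rfl <;> norm_num

/-- The inner product modulo 2 of two bit strings. -/
def dot (x y : ι → Bool) : ZMod 2 := ∑ i, if x i && y i then 1 else 0

/-- The Walsh characters of the cube. -/
def chi (x y : ι → Bool) : ℂ := sgn (dot x y)

/-- Bitwise exclusive or. -/
def bxor {ι : Type*} (x y : ι → Bool) : ι → Bool := fun i => xor (x i) (y i)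

lemma bxor_bxor_right {ι : Type*} (x y : ι → Bool) : bxor (bxor x y) y = x := by
  funext i; simp [bxor]

lemma bxor_right_injective {ι : Type*} (y : ι → Bool) :
    Function.Injective fun x => bxor x y := fun a b h => by
  rw [← bxor_bxor_right a y, ← bxor_bxor_right b y]; exact congrArg (bxor · y) h

lemma bxor_left_injective {ι : Type*} (y : ι → Bool) :
    Function.Injective fun x => bxor y x := fun a b h => by
  funext i; simpa [bxor] using congrFun h i

lemma dot_comm (x y : ι → Bool) : dot x y = dot y x := by
  simp only [dot, Bool.and_comm]

lemma chi_comm (x y : ι → Bool) : chi x y = chi y x := by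
  rw [chi, dot_comm, chi]

@[simp] lemma chi_false_right (x : ι → Bool) : chi x (fun _ => false) = 1 := by
  simp [chi, dot]

@[simp] lemma star_chi (x y : ι → Bool) : star (chi x y) = chi x y := star_sgn _

lemma chi_mul_self (x y : ι → Bool) : chi x y * chi x y = 1 := sgn_mul_self _

lemma norm_chi (x y : ι → Bool) : ‖chi x y‖ = 1 := by
  rcases zmod_two_eq_zero_or_one (dot x y) with h | h <;> simp [chi, h]

lemma chi_bxor_left (x z y : ι → Bool) : chi (bxor x z) y = chi x y * chi z y := by
  have h : (1 + 1 : ZMod 2) = 0 := by decide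
  rw [chi, chi, chi, ← sgn_add, dot, dot, dot, ← Finset.sum_add_distrib]
  congr 1
  refine Finset.sum_congr rfl fun i _ => ?_
  cases hx : x i <;> cases hz : z i <;> cases hy : y i <;> simp [bxor, hx, hz, h]

/-- The sum over the cube factors into a product over coordinates, and a coordinate where the
strings differ contributes 1 - 1 = 0. -/
lemma sum_chi_mul [DecidableEq ι] (x z : ι → Bool) :
    ∑ y, chi x y * chi y z = if x = z then 2 ^ Fintype.card ι else 0 := by
  have h1 : ∀ y : ι → Bool, chi x y * chi y z =
      ∏ i, (sgn (if x i && y i then 1 else 0) * sgn (if y i && z i then 1 else 0)) := fun y => by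
    rw [Finset.prod_mul_distrib, ← sgn_sum, ← sgn_sum]; rfl
  have h2 : ∀ i, ∑ b : Bool,
      (sgn (if x i && b then 1 else 0) * sgn (if b && z i then 1 else 0)) =
      if x i = z i then 2 else 0 := fun i => by
    cases x i <;> cases z i <;> norm_num
  rw [Finset.sum_congr rfl fun y _ => h1 y]
  have h3 := Finset.prod_univ_sum (fun _ : ι => (Finset.univ : Finset Bool)) fun i b =>
      sgn (if x i && b then 1 else 0) * sgn (if b && z i then 1 else 0)
  rw [Fintype.piFinset_univ] at h3
  rw [← h3, Finset.prod_congr rfl fun i _ => h2 i]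
  split_ifs with h
  · subst h; simp
  · obtain ⟨i, hi⟩ := Function.ne_iff.mp h
    exact Finset.prod_eq_zero (Finset.mem_univ i) (by simp [hi])

end Characters

/-! ### Isometries and signed basis maps. -/

section Isometries

variable {α β : Type*} [Fintype α] [DecidableEq α] [Fintype β] [DecidableEq β]

lemma ofReal_sum_norm_sq {γ : Type*} [Fintype γ] (w : γ → ℂ) :
    ((∑ c, ‖w c‖ ^ 2 : ℝ) : ℂ) = star w ⬝ᵥ w := by
  simp only [dotProduct, Pi.star_apply, RCLike.star_def, Complex.conj_mul']
  push_cast; rfl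

lemma sum_norm_sq_mulVec {M : Matrix α β ℂ} (hM : Mᴴ * M = 1) (v : β → ℂ) :
    ∑ a, ‖(M *ᵥ v) a‖ ^ 2 = ∑ b, ‖v b‖ ^ 2 := by
  have : ((∑ a, ‖(M *ᵥ v) a‖ ^ 2 : ℝ) : ℂ) = ((∑ b, ‖v b‖ ^ 2 : ℝ) : ℂ) := by
    rw [ofReal_sum_norm_sq, ofReal_sum_norm_sq, Matrix.star_mulVec, ← Matrix.dotProduct_mulVec, Matrix.mulVec_mulVec, hM,
      Matrix.one_mulVec]
  exact_mod_cast this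

/-- The matrix sending the basis vector `b` to `ε b` times the basis vector `σ b`. -/
def monomialMatrix (σ : β → α) (ε : β → ℂ) : Matrix α β ℂ :=
  Matrix.of fun a b => if a = σ b then ε b else 0

lemma monomialMatrix_isometry {σ : β → α} (hσ : Function.Injective σ) {ε : β → ℂ}
    (hε : ∀ b, star (ε b) * ε b = 1) :
    (monomialMatrix σ ε)ᴴ * monomialMatrix σ ε = 1 := by
  ext b b'
  rw [Matrix.mul_apply, Matrix.one_apply]
  simp only [Matrix.conjTranspose_apply, monomialMatrix, Matrix.of_apply, mul_ite, mul_zero,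
    Finset.sum_ite_eq', Finset.mem_univ, if_true]
  by_cases h : b = b'
  · subst h; simpa using hε b
  · rw [if_neg h]
    simp [hσ.eq_iff, Ne.symm h]

lemma monomialMatrix_mulVec (σ : β → α) (ε : β → ℂ) (v : β → ℂ) (a : α) :
    (monomialMatrix σ ε *ᵥ v) a = ∑ b, if a = σ b then ε b * v b else 0 := by
  simp [Matrix.mulVec, dotProduct, monomialMatrix, ite_mul]

lemma monomialMatrix_mulVec_single (σ : β → α) (ε : β → ℂ) (b : β) :
    monomialMatrix σ ε *ᵥ Pi.single b 1 = ε b • Pi.single (σ b) 1 := by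
  ext a
  simp [monomialMatrix, Pi.single_apply]

end Isometries

/-! ### Functions of low Fourier degree. -/

section LowDegree

variable {ι : Type*} [Fintype ι] [DecidableEq ι]

/-- The Walsh transform, without normalization. -/
def walsh (F : (ι → Bool) → ℂ) (S : ι → Bool) : ℂ := ∑ c, chi S c * F c

/-- The number of ones in a bit string. -/
def weight (S : ι → Bool) : ℕ := (Finset.univ.filter fun i => S i = true).card

/-- The functions on the cube of Fourier degree at most `t`. -/
def degreeLE (ι : Type*) [Fintype ι] [DecidableEq ι] (t : ℕ) :
    Submodule ℂ ((ι → Bool) → ℂ) where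
  carrier := {F | ∀ S, t < weight S → walsh F S = 0}
  zero_mem' := fun S _ => by simp [walsh]
  add_mem' := fun {F G} hF hG S hS => by
    have h : walsh (F + G) S = walsh F S + walsh G S := by
      simp [walsh, mul_add, Finset.sum_add_distrib]
    rw [h, hF S hS, hG S hS, add_zero]
  smul_mem' := fun a F hF S hS => by
    have h : walsh (a • F) S = a * walsh F S := by
      simp only [walsh, Finset.mul_sum, Pi.smul_apply, smul_eq_mul]
      exact Finset.sum_congr rfl fun c _ => by ring
    rw [h, hF S hS, mul_zero]

lemma degreeLE_succ {t : ℕ} {F : (ι → Bool) → ℂ} (hF : F ∈ degreeLE ι t) :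
    F ∈ degreeLE ι (t + 1) := fun S hS => hF S (by omega)

/-- The bit string with a single one, at `i`. -/
def unitString (i : ι) : ι → Bool := fun j => decide (j = i)

lemma chi_unitString (i : ι) (c : ι → Bool) : chi (unitString i) c = if c i then -1 else 1 := by
  have h : dot (unitString i) c = if c i then 1 else 0 := by
    rw [dot, Finset.sum_eq_single i]
    · simp [unitString]
    · intro j _ hj; simp [unitString, hj]
    · simp
  rw [chi, h]; split_ifs <;> simp

lemma weight_le_weight_bxor_unitString (S : ι → Bool) (i : ι) :
    weight S ≤ weight (bxor S (unitString i)) + 1 := by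
  refine (Finset.card_le_card fun j hj => ?_).trans
    (Finset.card_insert_le i (Finset.univ.filter fun j => bxor S (unitString i) j = true))
  by_cases h : j = i
  · simp [h]
  · have := (Finset.mem_filter.mp hj).2
    simp [bxor, unitString, h, this]

/-- Multiplying by a character translates the spectrum, here by a string of weight one. -/
lemma chi_unitString_mul_mem {t : ℕ} {F : (ι → Bool) → ℂ} (hF : F ∈ degreeLE ι t) (i : ι) :
    (fun c => chi (unitString i) c * F c) ∈ degreeLE ι (t + 1) := fun S hS => by
  have h : walsh (fun c => chi (unitString i) c * F c) S = walsh F (bxor S (unitString i)) := by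
    simp only [walsh, chi_bxor_left, mul_assoc]
  rw [h]
  exact hF _ (by have := weight_le_weight_bxor_unitString S i; omega)

/-- With χ the sign of bit i, the selected function is (G₀ + G₁)/2 + χ (G₀ - G₁)/2. This is why
reading one bit costs one degree. -/
lemma select_mem {t : ℕ} {G : Bool → (ι → Bool) → ℂ} (hG : ∀ b, G b ∈ degreeLE ι t) (i : ι) :
    (fun c => G (c i) c) ∈ degreeLE ι (t + 1) := by
  have h : (fun c => G (c i) c) = (1 / 2 : ℂ) • (G false + G true) +
      (1 / 2 : ℂ) • ((fun c => chi (unitString i) c * G false c) -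
        (fun c => chi (unitString i) c * G true c)) := by
    funext c
    simp only [Pi.add_apply, Pi.smul_apply, Pi.sub_apply, smul_eq_mul, chi_unitString]
    cases c i <;> simp <;> ring
  rw [h]
  exact Submodule.add_mem _
    (Submodule.smul_mem _ _ (degreeLE_succ (Submodule.add_mem _ (hG _) (hG _))))
    (Submodule.smul_mem _ _ (Submodule.sub_mem _ (chi_unitString_mul_mem (hG _) i)
      (chi_unitString_mul_mem (hG _) i)))

lemma const_mem_degreeLE (a : ℂ) : (fun _ => a) ∈ degreeLE ι 0 := fun S hS => by
  have h : S ≠ fun _ => false := by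
    rintro rfl; simp [weight] at hS
  have := sum_chi_mul S fun _ => false
  simp only [chi_false_right, mul_one, if_neg h] at this
  rw [walsh, ← Finset.sum_mul, this, zero_mul]

lemma walsh_inversion (F : (ι → Bool) → ℂ) (c : ι → Bool) :
    ∑ S, chi c S * walsh F S = 2 ^ Fintype.card ι * F c := by
  simp only [walsh, Finset.mul_sum, ← mul_assoc]
  rw [Finset.sum_comm]
  simp only [← Finset.sum_mul, sum_chi_mul, ite_mul, zero_mul, Finset.sum_ite_eq,
    Finset.mem_univ, if_true]

lemma walsh_parseval (F : (ι → Bool) → ℂ) :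
    ∑ S, ‖walsh F S‖ ^ 2 = 2 ^ Fintype.card ι * ∑ c, ‖F c‖ ^ 2 := by
  have h : ∑ S, star (walsh F S) * walsh F S = 2 ^ Fintype.card ι * ∑ c, star (F c) * F c := by
    have h1 : ∀ S, star (walsh F S) * walsh F S =
        ∑ c, star (F c) * (chi c S * walsh F S) := fun S => by
      have h0 : star (walsh F S) = ∑ c, star (chi S c * F c) := star_sum _ _
      rw [h0, Finset.sum_mul]
      exact Finset.sum_congr rfl fun c _ => by rw [star_mul', star_chi, chi_comm S c, mul_comm (chi c S), mul_assoc]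
    simp only [h1]
    rw [Finset.sum_comm, Finset.mul_sum]
    exact Finset.sum_congr rfl fun c _ => by rw [← Finset.mul_sum, walsh_inversion, mul_left_comm]
  simp only [RCLike.star_def, Complex.conj_mul'] at h
  exact_mod_cast h

/-- Complementation sends the strings of weight at most t injectively to strings of weight greater
than t. -/
lemma two_mul_card_weight_le {t : ℕ} (ht : 2 * t < Fintype.card ι) :
    2 * (Finset.univ.filter fun S : ι → Bool => weight S ≤ t).card ≤ 2 ^ Fintype.card ι := by
  set D := Finset.univ.filter fun S : ι → Bool => weight S ≤ t with hD
  let e : (ι → Bool) ↪ (ι → Bool) := ⟨fun S i => !S i, fun S R h => by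
    funext i; simpa using congrFun h i⟩
  have hdisj : Disjoint D (D.map e) := by
    rw [Finset.disjoint_left]
    intro S hS hS'
    obtain ⟨R, hR, rfl⟩ := Finset.mem_map.mp hS'
    have h1 : weight (e R) ≤ t := (Finset.mem_filter.mp hS).2
    have h2 : weight R ≤ t := (Finset.mem_filter.mp hR).2
    have h3 : weight R + weight (e R) = Fintype.card ι := by
      have h4 : weight (e R) = (Finset.univ.filter fun i => ¬ R i = true).card := by
        unfold weight
        congr 1
        ext i
        have he : e R i = !R i := rfl
        simp [he]
      rw [h4]
      exact Finset.card_filter_add_card_filter_not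
        (s := (Finset.univ : Finset ι)) (fun i => R i = true)
    omega
  have h := Finset.card_le_univ (D ∪ D.map e)
  rw [Finset.card_union_of_disjoint hdisj, Finset.card_map, Fintype.card_fun,
    Fintype.card_bool] at h
  omega

/-- Expand F c over the characters of weight at most t and apply Cauchy–Schwarz and Parseval: the
constant is the fraction of characters available, at most 1/2. -/
lemma norm_sq_le_of_mem_degreeLE {t : ℕ} (ht : 2 * t < Fintype.card ι) {F : (ι → Bool) → ℂ}
    (hF : F ∈ degreeLE ι t) (c : ι → Bool) : ‖F c‖ ^ 2 ≤ (1 / 2) * ∑ c', ‖F c'‖ ^ 2 := by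
  set D := Finset.univ.filter fun S : ι → Bool => weight S ≤ t with hD
  set N : ℝ := 2 ^ Fintype.card ι with hN
  have hNpos : 0 < N := by positivity
  have hcard : 2 * (D.card : ℝ) ≤ N := by
    rw [hN]; exact_mod_cast two_mul_card_weight_le ht
  have h1 : N * ‖F c‖ ≤ ∑ S ∈ D, ‖walsh F S‖ := by
    have h2 : ∑ S ∈ D, chi c S * walsh F S = 2 ^ Fintype.card ι * F c := by
      rw [← walsh_inversion]
      refine Finset.sum_subset (Finset.subset_univ _) fun S _ hS => ?_
      rw [hF S (by simpa [hD] using hS), mul_zero]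
    have h3 : N * ‖F c‖ = ‖∑ S ∈ D, chi c S * walsh F S‖ := by
      rw [h2, norm_mul, norm_pow, Complex.norm_ofNat]
    rw [h3]
    refine (norm_sum_le _ _).trans (le_of_eq (Finset.sum_congr rfl fun S _ => ?_))
    rw [norm_mul, norm_chi, one_mul]
  have h4 : (∑ S ∈ D, ‖walsh F S‖) ^ 2 ≤ D.card * ∑ S ∈ D, ‖walsh F S‖ ^ 2 :=
    sq_sum_le_card_mul_sum_sq
  have h5 : ∑ S ∈ D, ‖walsh F S‖ ^ 2 ≤ N * ∑ c', ‖F c'‖ ^ 2 := by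
    rw [← walsh_parseval]
    exact Finset.sum_le_sum_of_subset_of_nonneg (Finset.subset_univ _) fun _ _ _ => by positivity
  have h6 : N ^ 2 * ‖F c‖ ^ 2 ≤ N ^ 2 * ((1 / 2) * ∑ c', ‖F c'‖ ^ 2) := by
    calc N ^ 2 * ‖F c‖ ^ 2 = (N * ‖F c‖) ^ 2 := by ring
      _ ≤ (∑ S ∈ D, ‖walsh F S‖) ^ 2 := by gcongr
      _ ≤ D.card * ∑ S ∈ D, ‖walsh F S‖ ^ 2 := h4
      _ ≤ (N / 2) * (N * ∑ c', ‖F c'‖ ^ 2) := by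
        gcongr
        linarith
      _ = _ := by ring
  exact le_of_mul_le_mul_left h6 (by positivity)

end LowDegree

/-! ### The query lower bound by the polynomial method. -/

section QueryLowerBound

variable {X : Type*} {Y : Type*} [Fintype Y] [DecidableEq Y] {m : ℕ} [NeZero m] {T : ℕ}

lemma sum_norm_sq_query {W : Type} [Fintype W] (g : Y → ZMod m) (ψ : Y × ZMod m × W → ℂ) :
    ∑ s, ‖query g ψ s‖ ^ 2 = ∑ s, ‖ψ s‖ ^ 2 := by
  let e : Y × ZMod m × W ≃ Y × ZMod m × W :=
    { toFun := fun s => (s.1, s.2.1 - g s.1, s.2.2)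
      invFun := fun s => (s.1, s.2.1 + g s.1, s.2.2)
      left_inv := fun s => by simp
      right_inv := fun s => by simp }
  exact e.sum_comp fun s => ‖ψ s‖ ^ 2

lemma conjTranspose_mul_self_of_unitary {α : Type*} [Fintype α] [DecidableEq α]
    (U : Matrix.unitaryGroup α ℂ) : (U : Matrix α α ℂ)ᴴ * (U : Matrix α α ℂ) = 1 :=
  Matrix.mem_unitaryGroup_iff'.mp U.2

lemma sum_norm_sq_state (alg : QueryAlgorithm X Y m T) (g : Y → ZMod m) :
    ∀ (t : ℕ) (ht : t < T + 1), ∑ s, ‖alg.state g t ht s‖ ^ 2 = 1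
  | 0, ht => by
    rw [QueryAlgorithm.state, sum_norm_sq_mulVec (conjTranspose_mul_self_of_unitary _),
      Finset.sum_eq_single alg.start] <;> simp +contextual
  | t + 1, ht => by
    rw [QueryAlgorithm.state, sum_norm_sq_mulVec (conjTranspose_mul_self_of_unitary _),
      sum_norm_sq_query]
    exact sum_norm_sq_state alg g t _

variable {ι : Type*} [Fintype ι] [DecidableEq ι]

/-- If every query reads a single bit of `c`, the amplitudes after `t` queries have degree at most
`t` in `c`. -/
lemma state_mem_degreeLE (alg : QueryAlgorithm X Y m T) (idx : Y → ι) (h : Y → Bool → ZMod m) :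
    ∀ (t : ℕ) (ht : t < T + 1) (s : Y × ZMod m × alg.W),
      (fun c : ι → Bool => alg.state (fun y => h y (c (idx y))) t ht s) ∈ degreeLE ι t
  | 0, ht, s => const_mem_degreeLE _
  | t + 1, ht, s => by
    have key : (fun c : ι → Bool => alg.state (fun y => h y (c (idx y))) (t + 1) ht s) =
        ∑ s' : Y × ZMod m × alg.W, (alg.U ⟨t + 1, ht⟩).1 s s' • fun c : ι → Bool =>
          alg.state (fun y => h y (c (idx y))) t (Nat.lt_of_succ_lt ht)
            (s'.1, s'.2.1 - h s'.1 (c (idx s'.1)), s'.2.2) := by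
      funext c
      rw [Finset.sum_apply]
      rfl
    rw [key]
    refine Submodule.sum_mem _ fun s' _ => Submodule.smul_mem _ _ ?_
    exact select_mem (G := fun b c => alg.state (fun y => h y (c (idx y))) t
      (Nat.lt_of_succ_lt ht) (s'.1, s'.2.1 - h s'.1 b, s'.2.2))
      (fun b => state_mem_degreeLE alg idx h t _ _) (idx s'.1)

/-- Identifying an `n`-bit string from its bits takes at least `n / 2` quantum queries. -/
theorem card_le_two_mul_queries (alg : QueryAlgorithm X Y m T) (idx : Y → ι)
    (h : Y → Bool → ZMod m) {g : (ι → Bool) → X} (hg : Function.Injective g)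
    (hsucc : ∀ c, 2 / 3 ≤ alg.outputProb (fun y => h y (c (idx y))) (g c)) :
    Fintype.card ι ≤ 2 * T := by
  classical
  by_contra! hT
  set F : Y × ZMod m × alg.W → (ι → Bool) → ℂ := fun s c =>
    alg.state (fun y => h y (c (idx y))) T (Nat.lt_succ_self T) s with hF
  set N : ℝ := 2 ^ Fintype.card ι with hN
  have hNpos : 0 < N := by positivity
  have h1 : N * (2 / 3) ≤
      ∑ c : ι → Bool, alg.outputProb (fun y => h y (c (idx y))) (g c) := by
    have := Finset.card_nsmul_le_sum (Finset.univ : Finset (ι → Bool)) _ _ fun c _ => hsucc c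
    simpa [hN] using this
  -- As g is injective, each measurement outcome is a correct answer for at most one c, so only a
  -- single point value of F s has to be bounded.
  have h2 : ∀ s, ∑ c : ι → Bool, (if alg.out s = g c then ‖F s c‖ ^ 2 else 0) ≤
      (1 / 2) * ∑ c, ‖F s c‖ ^ 2 := fun s => by
    by_cases hs : ∃ c, alg.out s = g c
    · obtain ⟨c, hc⟩ := hs
      simp only [hc, hg.eq_iff, Finset.sum_ite_eq, Finset.mem_univ, if_true]
      exact norm_sq_le_of_mem_degreeLE hT (state_mem_degreeLE alg idx h T _ s) c
    · push Not at hs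
      simp only [hs, if_false, Finset.sum_const_zero]
      positivity
  have h3 : ∑ c : ι → Bool, alg.outputProb (fun y => h y (c (idx y))) (g c) ≤ (1 / 2) * N := by
    calc _ = ∑ c : ι → Bool, ∑ s, (if alg.out s = g c then ‖F s c‖ ^ 2 else 0) := by
          refine Finset.sum_congr rfl fun c _ => ?_
          simp only [QueryAlgorithm.outputProb, hF]
      _ = ∑ s, ∑ c : ι → Bool, (if alg.out s = g c then ‖F s c‖ ^ 2 else 0) := Finset.sum_comm
      _ ≤ ∑ s, (1 / 2) * ∑ c, ‖F s c‖ ^ 2 := Finset.sum_le_sum fun s _ => h2 s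
      _ = (1 / 2) * ∑ c : ι → Bool, ∑ s, ‖F s c‖ ^ 2 := by
          rw [← Finset.mul_sum, Finset.sum_comm]
      _ = (1 / 2) * N := by
          simp only [hF, sum_norm_sq_state]
          simp [hN]
  linarith

end QueryLowerBound

/-! ### The exact q-query algorithm. -/

section BernsteinVazirani

variable {ι : Type} [Fintype ι] [DecidableEq ι] {q : ℕ} [NeZero q]

/-- The oracle answers: the inner product of the `i`-th block of `d` with `y`. -/
def blockDot (d : Fin q → ι → Bool) (y : Fin q × (ι → Bool)) : ZMod 2 := dot (d y.1) y.2

/-- The Walsh–Hadamard transform on the query string and the answer bit. -/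
noncomputable def hadamard (ι W : Type) [Fintype ι] [DecidableEq W] (q : ℕ) :
    Matrix ((Fin q × (ι → Bool)) × ZMod 2 × W) ((Fin q × (ι → Bool)) × ZMod 2 × W) ℂ :=
  Matrix.of fun s s' => (if s.1.1 = s'.1.1 then 1 else 0) * (if s.2.2 = s'.2.2 then 1 else 0) *
    (chi s.1.2 s'.1.2 * sgn (s.2.1 * s'.2.1)) * ((√(2 ^ (Fintype.card ι + 1)) : ℝ) : ℂ)⁻¹

variable {W : Type} [Fintype W] [DecidableEq W]

/-- The matrix is the identity on the block index and the workspace, and a normalized character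
table on the other two factors, so orthogonality of characters applies. -/
lemma hadamard_mul_self : hadamard ι W q * hadamard ι W q = 1 := by
  have hc : (((√(2 ^ (Fintype.card ι + 1)) : ℝ) : ℂ)⁻¹) * ((√(2 ^ (Fintype.card ι + 1)) : ℝ) : ℂ)⁻¹ =
      (2 ^ (Fintype.card ι + 1))⁻¹ := by
    rw [← mul_inv, ← Complex.ofReal_mul, Real.mul_self_sqrt (by positivity)]
    push_cast; rfl
  ext ⟨⟨i, y⟩, a, w⟩ ⟨⟨i', y'⟩, a', w'⟩
  rw [Matrix.mul_apply]
  set c := ((√(2 ^ (Fintype.card ι + 1)) : ℝ) : ℂ)⁻¹ with hcdef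
  have h : ∑ s, hadamard ι W q ((i, y), a, w) s * hadamard ι W q s ((i', y'), a', w') =
      (∑ j, (if i = j then 1 else 0) * (if j = i' then 1 else 0)) *
      (∑ z, chi y z * chi z y') * (∑ b, sgn (a * b) * sgn (b * a')) *
      (∑ v, (if w = v then 1 else 0) * (if v = w' then 1 else 0)) * (c * c) := by
    have h' : ∀ j z b v, hadamard ι W q ((i, y), a, w) ((j, z), b, v) *
        hadamard ι W q ((j, z), b, v) ((i', y'), a', w') =
        ((if i = j then 1 else 0) * (if j = i' then 1 else 0)) * (chi y z * chi z y') *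
        (sgn (a * b) * sgn (b * a')) *
        ((if w = v then 1 else 0) * (if v = w' then 1 else 0)) * (c * c) := fun j z b v => by
      simp only [hadamard, Matrix.of_apply]
      ring
    have fac : ∀ (f : Fin q → ℂ) (g : (ι → Bool) → ℂ) (h : ZMod 2 → ℂ) (k : W → ℂ),
        ∑ j, ∑ z, ∑ b, ∑ v, f j * g z * h b * k v =
          (∑ j, f j) * (∑ z, g z) * (∑ b, h b) * ∑ v, k v := fun f g h k => by
      simp only [← Finset.mul_sum, ← Finset.sum_mul]
    simp only [Fintype.sum_prod_type, h', ← Finset.sum_mul]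
    exact congrArg (· * (c * c)) (fac (fun j => (if i = j then 1 else 0) * (if j = i' then 1 else 0))
      (fun z => chi y z * chi z y') (fun b => sgn (a * b) * sgn (b * a'))
      (fun v => (if w = v then 1 else 0) * (if v = w' then 1 else 0)))
  rw [h, hc, sum_chi_mul, sum_sgn_mul]
  simp only [mul_ite, mul_one, mul_zero, Finset.sum_ite_eq', Finset.mem_univ, if_true,
    Matrix.one_apply, Prod.mk.injEq]
  by_cases h1 : i = i' <;> by_cases h2 : y = y' <;> by_cases h3 : a = a' <;>
    by_cases h4 : w = w' <;> simp [h1, h2, h3, h4]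
  field_simp
  rw [pow_succ]

lemma hadamard_isHermitian : (hadamard ι W q)ᴴ = hadamard ι W q := by
  ext s s'
  simp only [hadamard, Matrix.conjTranspose_apply, Matrix.of_apply, star_mul', star_chi, star_sgn,
    chi_comm s'.1.2, mul_comm s'.2.1, eq_comm (a := s'.1.1), eq_comm (a := s'.2.2),
    star_inv₀, RCLike.star_def, Complex.conj_ofReal]
  congr 2
  split_ifs <;> simp

lemma hadamard_isometry : (hadamard ι W q)ᴴ * hadamard ι W q = 1 := by
  rw [hadamard_isHermitian, hadamard_mul_self]

lemma hadamard_mulVec_single_of_ne {s s' : (Fin q × (ι → Bool)) × ZMod 2 × W}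
    (h : s.2.2 ≠ s'.2.2) : (hadamard ι W q *ᵥ Pi.single s' 1) s = 0 := by
  rw [Matrix.mulVec_single_one, Matrix.col_apply]
  simp [hadamard, h]

/-- A query imprints the queried block as a phase. -/
lemma query_hadamard (d : Fin q → ι → Bool) (i : Fin q) (w : W) :
    query (blockDot d) (hadamard ι W q *ᵥ Pi.single ((i, fun _ => false), 1, w) 1) =
      hadamard ι W q *ᵥ Pi.single ((i, d i), 1, w) 1 := by
  funext s
  simp only [query, Matrix.mulVec_single_one, Matrix.col_apply, hadamard, Matrix.of_apply,
    chi_false_right, one_mul, mul_one, sgn_sub]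
  by_cases h : s.1.1 = i
  · subst h
    rw [chi_comm s.1.2 (d s.1.1)]
    simp only [blockDot, chi]
    ring
  · simp [h]

/-- Store the measured block in the workspace and move on to the next block. -/
def storeEquiv (ι : Type) (q : ℕ) [NeZero q] :
    (Fin q × (ι → Bool)) × ZMod 2 × (Fin q → ι → Bool) ≃
      (Fin q × (ι → Bool)) × ZMod 2 × (Fin q → ι → Bool) where
  toFun s := ((s.1.1 + 1, s.2.2 s.1.1), s.2.1, Function.update s.2.2 s.1.1 s.1.2)
  invFun s := ((s.1.1 - 1, s.2.2 (s.1.1 - 1)), s.2.1,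
    Function.update s.2.2 (s.1.1 - 1) s.1.2)
  left_inv s := by simp
  right_inv s := by simp

/-- The first `t` blocks of `d`, the others replaced by zero. -/
def prefixBlocks (d : Fin q → ι → Bool) (t : ℕ) : Fin q → ι → Bool :=
  fun i => if (i : ℕ) < t then d i else fun _ => false

/-- The Bernstein–Vazirani algorithm run on one block after the other. -/
noncomputable abbrev blockAlgorithm {X : Type*} (out : (Fin q → ι → Bool) → X) :
    QueryAlgorithm X (Fin q × (ι → Bool)) 2 q where
  W := Fin q → ι → Bool
  -- Answer bit 1 is transformed into the minus state, on which a query acts as a phase.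
  start := ((0, fun _ => false), 1, fun _ _ => false)
  -- Between queries: decode the block, store it, and prepare the uniform superposition for the next
  -- block.
  U t := if t = 0 then ⟨hadamard ι _ q, Matrix.mem_unitaryGroup_iff'.mpr hadamard_isometry⟩ else
    ⟨hadamard ι _ q, Matrix.mem_unitaryGroup_iff'.mpr hadamard_isometry⟩ *
    ⟨monomialMatrix (storeEquiv ι q) fun _ => 1, Matrix.mem_unitaryGroup_iff'.mpr
      (monomialMatrix_isometry (storeEquiv ι q).injective (by simp))⟩ *
    ⟨hadamard ι _ q, Matrix.mem_unitaryGroup_iff'.mpr hadamard_isometry⟩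
  out s := out s.2.2

/-- The invariant: every query meets a transformed basis state with cleared query string. At t = q
the block index wraps around to 0, which is harmless. -/
lemma blockAlgorithm_state {X : Type*} (out : (Fin q → ι → Bool) → X) (d : Fin q → ι → Bool) :
    ∀ (t : ℕ) (ht : t < q + 1), (blockAlgorithm out).state (blockDot d) t ht =
      hadamard ι _ q *ᵥ Pi.single ((Fin.ofNat q t, fun _ => false), 1, prefixBlocks d t) 1
  | 0, ht => by
    have h : prefixBlocks d 0 = fun _ _ => false := by funext i; simp [prefixBlocks]
    rw [h]
    rfl
  | t + 1, ht => by
    have htq : t < q := by omega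
    have hval : ((Fin.ofNat q t : Fin q) : ℕ) = t := by simp [Nat.mod_eq_of_lt htq]
    have hU : ((blockAlgorithm out).U ⟨t + 1, ht⟩ : Matrix _ _ ℂ) =
        hadamard ι _ q * monomialMatrix (storeEquiv ι q) (fun _ => 1) * hadamard ι _ q := by
      simp only [blockAlgorithm]
      rw [if_neg (by simp [Fin.ext_iff])]
      rfl
    rw [QueryAlgorithm.state, hU, blockAlgorithm_state out d t]
    erw [query_hadamard]
    rw [Matrix.mulVec_mulVec, mul_assoc, mul_assoc, hadamard_mul_self, mul_one,
      ← Matrix.mulVec_mulVec, monomialMatrix_mulVec_single, one_smul]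
    congr 2
    have h1 : (Fin.ofNat q t : Fin q) + 1 = Fin.ofNat q (t + 1) := by
      ext; simp [Fin.val_add, Nat.add_mod]
    -- Storing is a swap, as it must be reversible; slot t is still empty, so the swap also clears
    -- the query string.
    have h2 : prefixBlocks d t (Fin.ofNat q t) = fun _ => false := by
      simp only [prefixBlocks]; rw [if_neg (by omega)]
    have h3 : Function.update (prefixBlocks d t) (Fin.ofNat q t) (d (Fin.ofNat q t)) =
        prefixBlocks d (t + 1) := by
      funext i
      by_cases hi : i = Fin.ofNat q t
      · subst hi
        simp [prefixBlocks, Nat.mod_eq_of_lt htq]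
      · have hi' : (i : ℕ) ≠ t := fun h => hi (Fin.ext (by rw [h, hval]))
        rw [Function.update_of_ne hi]
        simp only [prefixBlocks]
        exact if_congr (by omega) rfl rfl
    simp only [storeEquiv, Equiv.coe_fn_mk, h1, h2, h3]

/-- The block algorithm identifies `x` with certainty. -/
lemma blockAlgorithm_outputProb {X : Type*} (out : (Fin q → ι → Bool) → X)
    (d : Fin q → ι → Bool) : (blockAlgorithm out).outputProb (blockDot d) (out d) = 1 := by
  have hd : prefixBlocks d q = d := by funext i; simp [prefixBlocks]
  have hs : (blockAlgorithm out).state (blockDot d) q (Nat.lt_succ_self q) =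
      hadamard ι (Fin q → ι → Bool) q *ᵥ
        Pi.single ((Fin.ofNat q q, fun _ => false), 1, d) 1 := by
    rw [blockAlgorithm_state, hd]
  have h : (blockAlgorithm out).outputProb (blockDot d) (out d) =
      ∑ s, ‖(hadamard ι (Fin q → ι → Bool) q *ᵥ
        Pi.single ((Fin.ofNat q q, fun _ => false), 1, d) 1) s‖ ^ 2 := by
    rw [QueryAlgorithm.outputProb, hs]
    refine Finset.sum_congr rfl fun s _ => ?_
    split_ifs with h
    · rfl
    -- A wrong answer forces a workspace other than d, and the final transform leaves the workspace
    -- untouched.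
    · have hne : s.2.2 ≠ d := fun h' => h (by rw [← h'])
      rw [hadamard_mulVec_single_of_ne hne, norm_zero, zero_pow two_ne_zero]
  rw [h, sum_norm_sq_mulVec hadamard_isometry,
    Finset.sum_eq_single ((Fin.ofNat q q, fun _ => false), 1, d)] <;>
    simp +contextual

end BernsteinVazirani

/-! ### The communication protocol. -/

section SuperdenseCoding

variable {k l q : ℕ}

/-- The Bell basis of `k` pairs of qubits. -/
noncomputable def bell (m : Fin k ⊕ Fin k → Bool) (p : Qubits k × Qubits k) : ℂ :=
  if p.2 = bxor p.1 (m ∘ Sum.inr) then chi (m ∘ Sum.inl) p.1 * ((√(2 ^ k) : ℝ) : ℂ)⁻¹ else 0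

lemma inv_sqrt_two_pow_mul_self (k : ℕ) :
    ((√(2 ^ k) : ℝ) : ℂ)⁻¹ * ((√(2 ^ k) : ℝ) : ℂ)⁻¹ = (2 ^ k)⁻¹ := by
  rw [← mul_inv, ← Complex.ofReal_mul, Real.mul_self_sqrt (by positivity)]
  push_cast; rfl

@[simp] lemma star_bell (m : Fin k ⊕ Fin k → Bool) (p : Qubits k × Qubits k) :
    star (bell m p) = bell m p := by
  unfold bell
  split_ifs
  · rw [star_mul', star_chi, star_inv₀, RCLike.star_def, Complex.conj_ofReal]
  · simp

/-- Vectors with different shifts have disjoint supports; for equal shifts, orthogonality of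
characters decides. -/
lemma sum_bell_mul_bell (m m' : Fin k ⊕ Fin k → Bool) :
    ∑ p, bell m p * bell m' p = if m = m' then 1 else 0 := by
  have h1 : ∀ b : Qubits k, ∑ s, bell m (b, s) * bell m' (b, s) =
      if m ∘ Sum.inr = m' ∘ Sum.inr then
        (chi (m ∘ Sum.inl) b * chi b (m' ∘ Sum.inl)) * (2 ^ k)⁻¹ else 0 := fun b => by
    rw [Finset.sum_eq_single (bxor b (m ∘ Sum.inr))]
    · simp only [bell, if_true, (bxor_left_injective b).eq_iff]
      split_ifs
      · rw [← inv_sqrt_two_pow_mul_self, chi_comm b]; ring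
      · simp
    · intro s _ hs
      simp [bell, hs]
    · simp
  rw [Fintype.sum_prod_type, Finset.sum_congr rfl fun b _ => h1 b]
  by_cases hr : m ∘ Sum.inr = m' ∘ Sum.inr
  · simp only [hr, if_true]
    rw [← Finset.sum_mul, sum_chi_mul, Fintype.card_fin]
    by_cases hl : m ∘ Sum.inl = m' ∘ Sum.inl
    · have hm : m = m' := by
        funext i
        rcases i with i | i
        · exact congrFun hl i
        · exact congrFun hr i
      rw [if_pos hl, if_pos hm, mul_inv_cancel₀ (pow_ne_zero _ two_ne_zero)]
    · rw [if_neg hl, if_neg (fun h => hl (by rw [h])), zero_mul]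
  · have hm : m ≠ m' := fun h => hr (by rw [h])
    simp [hr, hm]

/-- Completeness of the Bell basis: a square matrix with a right inverse has it as left inverse too.
-/
lemma sum_bell_mul_bell' (p p' : Qubits k × Qubits k) :
    ∑ m, bell m p * bell m p' = if p = p' then 1 else 0 := by
  let M : Matrix (Fin k ⊕ Fin k → Bool) (Qubits k × Qubits k) ℂ := Matrix.of bell
  have h : M * Mᵀ = 1 := by
    ext m m'
    rw [Matrix.mul_apply, Matrix.one_apply]
    exact sum_bell_mul_bell m m'
  have h' : Mᵀ * M = 1 :=
    (Matrix.mul_eq_one_comm_of_equiv (Equiv.sumArrowEquivProdArrow _ _ _)).mp h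
  have := congrFun (congrFun h' p) p'
  rwa [Matrix.mul_apply, Matrix.one_apply] at this

/-- Bob's first move: he sends the index of the block he is interested in. -/
noncomputable def sendIndex (code : Fin q → Qubits l) (i : Fin q) :
    Matrix (Qubits k × Qubits l) (Qubits k) ℂ :=
  monomialMatrix (fun b => (b, code i)) fun _ => 1

lemma sendIndex_isometry (code : Fin q → Qubits l) (i : Fin q) :
    (sendIndex (k := k) code i)ᴴ * sendIndex (k := k) code i = 1 :=
  monomialMatrix_isometry (fun _ _ h => (Prod.mk.inj h).1) (by simp)

/-- Alice's move: she encodes the block asked for in her half of the entangled pairs by Pauli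
operators and sends it. -/
noncomputable def sendBlock (dec : Qubits l → Fin q) (d : Fin q → Fin k ⊕ Fin k → Bool) :
    Matrix (Qubits l × Qubits k) (Qubits k × Qubits l) ℂ :=
  monomialMatrix (fun p => (p.2, bxor p.1 (d (dec p.2) ∘ Sum.inr)))
    fun p => chi (d (dec p.2) ∘ Sum.inl) p.1

lemma sendBlock_isometry (dec : Qubits l → Fin q) (d : Fin q → Fin k ⊕ Fin k → Bool) :
    (sendBlock dec d)ᴴ * sendBlock dec d = 1 := by
  refine monomialMatrix_isometry ?_ fun p => by rw [star_chi, chi_mul_self]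
  rintro ⟨a, c⟩ ⟨a', c'⟩ h
  obtain ⟨rfl, h2⟩ := Prod.mk.inj h
  exact congrArg (·, c) (bxor_right_injective _ h2)

/-- Bob's last move: he measures in the Bell basis and computes the answer. -/
noncomputable def decodeBlock (y : Fin k ⊕ Fin k → Bool) :
    Matrix (ZMod 2 × (Fin k ⊕ Fin k → Bool)) (Qubits k × Qubits k) ℂ :=
  Matrix.of fun s p => if s.1 = dot s.2 y then bell s.2 p else 0

/-- For each Bell outcome exactly one answer z contributes, so the claim reduces to completeness of
the Bell basis. -/
lemma decodeBlock_isometry (y : Fin k ⊕ Fin k → Bool) :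
    (decodeBlock y)ᴴ * decodeBlock y = 1 := by
  ext p p'
  rw [Matrix.mul_apply, Matrix.one_apply, ← sum_bell_mul_bell', Fintype.sum_prod_type,
    Finset.sum_comm]
  refine Finset.sum_congr rfl fun m _ => ?_
  rw [Finset.sum_eq_single (dot m y)]
  · simp [decodeBlock, -RCLike.star_def]
  · intro z _ hz
    simp [decodeBlock, hz]
  · simp

/-- Bob asks for a block, which Alice sends by superdense coding. -/
noncomputable def blockProtocol {X : Type*} (code : Fin q → Qubits l) (dec : Qubits l → Fin q)
    (e : X → Fin q → Fin k ⊕ Fin k → Bool) :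
    CommProtocol X (Fin q × (Fin k ⊕ Fin k → Bool)) 2 (Qubits k) (Qubits k) :=
  .bobSends l (Qubits k) (fun y => sendIndex code y.1) (fun y => sendIndex_isometry code y.1) <|
  .aliceSends k (Qubits l) (fun x => sendBlock dec (e x)) (fun x => sendBlock_isometry dec (e x)) <|
  .output (Fin k ⊕ Fin k → Bool) (fun y => decodeBlock y.2) fun y => decodeBlock_isometry y.2

/-- `k` maximally entangled pairs of qubits. -/
noncomputable def maximallyEntangled (k : ℕ) (s : Qubits k × Qubits k) : ℂ :=
  if s.1 = s.2 then ((√(2 ^ k) : ℝ) : ℂ)⁻¹ else 0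

lemma sum_norm_sq_maximallyEntangled (k : ℕ) : ∑ s, ‖maximallyEntangled k s‖ ^ 2 = 1 := by
  have h : ∀ a : Qubits k, ∑ b, ‖maximallyEntangled k (a, b)‖ ^ 2 = (2 ^ k)⁻¹ := fun a => by
    rw [Finset.sum_eq_single a]
    · simp [maximallyEntangled]
    · intro b _ hb
      simp [maximallyEntangled, Ne.symm hb]
    · simp
  rw [Fintype.sum_prod_type, Finset.sum_congr rfl fun a _ => h a]
  simp

lemma sendIndex_mulVec (code : Fin q → Qubits l) (i : Fin q) (v : Qubits k → ℂ)
    (b : Qubits k) (c : Qubits l) :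
    (sendIndex code i *ᵥ v) (b, c) = if c = code i then v b else 0 := by
  rw [sendIndex, monomialMatrix_mulVec, Finset.sum_eq_single b]
  · simp
  · intro b' _ hb'
    simp [Ne.symm hb']
  · simp

/-- The heart of superdense coding: a Pauli operator on Alice's half alone turns the maximally
entangled state into the Bell vector labelled by all 2k bits. -/
lemma sendBlock_mulVec (dec : Qubits l → Fin q) (d : Fin q → Fin k ⊕ Fin k → Bool)
    (c : Qubits l) (b s : Qubits k) (c' : Qubits l) :
    (sendBlock dec d *ᵥ fun p => if p.2 = c then maximallyEntangled k (p.1, b) else 0) (c', s) =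
      if c' = c then bell (d (dec c)) (b, s) else 0 := by
  rw [sendBlock, monomialMatrix_mulVec, Finset.sum_eq_single (b, c)]
  · by_cases hc : c' = c <;> simp [bell, maximallyEntangled, hc]
  · rintro ⟨a, c''⟩ _ h
    by_cases hc : c'' = c
    · subst hc
      have : a ≠ b := fun h' => h (by rw [h'])
      simp [maximallyEntangled, this]
    · simp [hc]
  · simp

lemma decodeBlock_mulVec_bell (y m : Fin k ⊕ Fin k → Bool) (z : ZMod 2)
    (m' : Fin k ⊕ Fin k → Bool) :
    (decodeBlock y *ᵥ bell m) (z, m') = if z = dot m y ∧ m' = m then 1 else 0 := by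
  simp only [Matrix.mulVec, dotProduct, decodeBlock, Matrix.of_apply, ite_mul, zero_mul]
  by_cases hm : m' = m
  · subst hm
    by_cases hz : z = dot m' y <;> simp [hz, sum_bell_mul_bell]
  · by_cases hz : z = dot m' y <;> simp [hz, sum_bell_mul_bell, hm]

lemma blockProtocol_outputProb {X : Type*} {code : Fin q → Qubits l} {dec : Qubits l → Fin q}
    (hdec : ∀ i, dec (code i) = i) (e : X → Fin q → Fin k ⊕ Fin k → Bool) (x : X)
    (y : Fin q × (Fin k ⊕ Fin k → Bool)) :
    (blockProtocol code dec e).outputProb x y (maximallyEntangled k) (dot (e x y.1) y.2) = 1 := by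
  have h : ∀ (c : Qubits l) (m : Fin k ⊕ Fin k → Bool),
      (decodeBlock y.2 *ᵥ fun p : Qubits k × Qubits k =>
        if c = code y.1 then bell (e x y.1) (p.1, p.2) else 0) (dot (e x y.1) y.2, m) =
      if c = code y.1 ∧ m = e x y.1 then 1 else 0 := fun c m => by
    by_cases hc : c = code y.1
    · simp only [hc, if_true, true_and]
      rw [decodeBlock_mulVec_bell]
      simp
    · simp only [hc, if_false, false_and]
      exact congrFun (Matrix.mulVec_zero _) _
  simp only [blockProtocol, CommProtocol.outputProb, sendIndex_mulVec, sendBlock_mulVec, hdec, h]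
  rw [Finset.sum_eq_single (code y.1), Finset.sum_eq_single (e x y.1)] <;>
    simp +contextual

end SuperdenseCoding

/-! ### Bounds for the block function and the final arithmetic. -/

section Tradeoff

/-- This provides the encoding of X: a subset of M of size |X| is chosen to contain the range of g,
which will be the cube behind the lower bound. -/
lemma exists_injective_of_card_le {S M X : Type*} [Fintype S] [Fintype M] [Fintype X]
    {g : S → M} (hg : Function.Injective g) (hS : Fintype.card S ≤ Fintype.card X)
    (hM : Fintype.card X ≤ Fintype.card M) :
    ∃ e : X → M, Function.Injective e ∧ ∀ s, ∃ x, e x = g s := by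
  classical
  obtain ⟨u, hu, -, hcard⟩ := Finset.exists_subsuperset_card_eq
    (Finset.subset_univ (Finset.univ.map ⟨g, hg⟩)) (n := Fintype.card X)
    (by simpa using hS) (by simpa using hM)
  let E : X ≃ u := Fintype.equivOfCardEq (by simp [hcard])
  refine ⟨fun x => E x, Subtype.val_injective.comp E.injective, fun s => ?_⟩
  exact ⟨E.symm ⟨g s, hu (by simp)⟩, by simp⟩

lemma Qoip_le {X Y : Type*} [Fintype Y] [DecidableEq Y] {m : ℕ} [NeZero m] {ε : ℝ}
    {f : X → Y → ZMod m} {T : ℕ} (alg : QueryAlgorithm X Y m T)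
    (h : ∀ x, 1 - ε ≤ alg.outputProb (f x) x) : Qoip ε f ≤ T :=
  sInf_le ⟨T, alg, h, rfl⟩

lemma exists_algorithm_of_Qoip_eq {X Y : Type*} [Fintype Y] [DecidableEq Y] {m : ℕ} [NeZero m]
    {ε : ℝ} {f : X → Y → ZMod m} {Q : ℕ} (hQ : Qoip ε f = Q) :
    ∃ alg : QueryAlgorithm X Y m Q, ∀ x, 1 - ε ≤ alg.outputProb (f x) x := by
  -- The infimum of the empty set is `⊤`, so a finite value means that the infimum is attained.
  have hne : {c : ℕ∞ | ∃ (T : ℕ) (alg : QueryAlgorithm X Y m T),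
      (∀ x, 1 - ε ≤ alg.outputProb (f x) x) ∧ (T : ℕ∞) = c}.Nonempty := by
    rw [Set.nonempty_iff_ne_empty]
    intro h
    rw [Qoip, h, sInf_empty] at hQ
    exact ENat.top_ne_natCast _ hQ
  obtain ⟨T, alg, h, hT⟩ := csInf_mem hne
  obtain rfl : T = Q := by
    have : (T : ℕ∞) = Q := hT.trans hQ
    exact_mod_cast this
  exact ⟨alg, h⟩

lemma Qcc_le {X Y : Type*} {m : ℕ} [NeZero m] {ε : ℝ} {f : X → Y → ZMod m} {A B : Type}
    [Fintype A] [DecidableEq A] [Fintype B] [DecidableEq B] (P : CommProtocol X Y m A B)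
    {φ : A × B → ℂ} (hφ : ∑ s, ‖φ s‖ ^ 2 = 1)
    (h : ∀ x y, 1 - ε ≤ P.outputProb x y φ (f x y)) : Qcc ε f ≤ P.cost :=
  sInf_le ⟨A, B, _, _, _, _, P, φ, hφ, h, rfl⟩

variable {X : Type*} {k q : ℕ}

theorem Qoip_blockDot_le [NeZero q] [Nonempty X] {e : X → Fin q → Fin k ⊕ Fin k → Bool}
    (he : Function.Injective e) : Qoip (1 / 3) (fun x => blockDot (e x)) ≤ q := by
  refine Qoip_le (blockAlgorithm (Function.invFun e)) fun x => ?_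
  have h := blockAlgorithm_outputProb (Function.invFun e) (e x)
  rw [Function.leftInverse_invFun he x] at h
  rw [h]
  norm_num

theorem Qcc_blockDot_le (hq : 0 < q) (e : X → Fin q → Fin k ⊕ Fin k → Bool) :
    Qcc (1 / 3) (fun x => blockDot (e x)) ≤ ((Nat.clog 2 q + k : ℕ) : ℕ∞) := by
  have : Nonempty (Fin q) := ⟨⟨0, hq⟩⟩
  obtain ⟨code⟩ : Nonempty (Fin q ↪ Qubits (Nat.clog 2 q)) :=
    Function.Embedding.nonempty_of_card_le (by simpa using Nat.le_pow_clog one_lt_two q)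
  have hdec : ∀ i, Function.invFun code (code i) = i :=
    Function.leftInverse_invFun code.injective
  refine Qcc_le (blockProtocol code (Function.invFun code) e)
    (sum_norm_sq_maximallyEntangled k) fun x y => ?_
  have h := blockProtocol_outputProb hdec e x y
  rw [blockDot, h]
  norm_num

/-- The string whose bit at `j₀` is `b`, all others being zero. -/
def singleBit {ι : Type*} [DecidableEq ι] (j₀ : ι) (b : Bool) : ι → Bool :=
  fun j => if j = j₀ then b else false

lemma dot_singleBit {ι : Type*} [Fintype ι] [DecidableEq ι] (j₀ : ι) (b : Bool) (y : ι → Bool) :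
    dot (singleBit j₀ b) y = if b && y j₀ then 1 else 0 := by
  rw [dot, Finset.sum_eq_single j₀]
  · simp [singleBit]
  · intro j _ hj; simp [singleBit, hj]
  · simp

theorem le_two_mul_of_Qoip_blockDot_eq {e : X → Fin q → Fin k ⊕ Fin k → Bool}
    (j₀ : Fin k ⊕ Fin k) (he : ∀ c : Fin q → Bool, ∃ x, e x = fun i => singleBit j₀ (c i)) {Q : ℕ}
    (hQ : Qoip (1 / 3) (fun x => blockDot (e x)) = Q) : q ≤ 2 * Q := by
  obtain ⟨alg, halg⟩ := exists_algorithm_of_Qoip_eq hQ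
  choose g hg using he
  have hginj : Function.Injective g := fun c c' h => by
    funext i
    have h1 : singleBit j₀ (c i) = singleBit j₀ (c' i) :=
      congrFun ((hg c).symm.trans ((congrArg e h).trans (hg c'))) i
    simpa [singleBit] using congrFun h1 j₀
  -- When each block has a single free bit, the answer to (i, y) is that bit of block i masked by y
  -- at j₀.
  have h := card_le_two_mul_queries alg Prod.fst
    (fun y b => if b && y.2 j₀ then 1 else 0) hginj fun c => by
      have h1 : (fun y : Fin q × (Fin k ⊕ Fin k → Bool) =>
          (if c y.1 && y.2 j₀ then 1 else 0 : ZMod 2)) = blockDot (e (g c)) := by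
        funext y
        rw [blockDot, hg, dot_singleBit]
      have h2 := halg (g c)
      rw [h1]
      linarith
  simpa using h

/-- Since q ≤ 2Q, the left side is at most 2Q log Q + 6Q. For Q ≥ 2 this is at most 8Q log Q; for Q
= 1 the logarithm vanishes and the additive 1 absorbs the 6. -/
lemma mul_logb_two_add_le {q Q : ℕ} (hQ : 0 < Q) (hqQ : q ≤ 2 * Q) (hq : 0 < q) :
    (q : ℝ) * Real.logb 2 q + 2 * q ≤ 8 * (Q * Real.logb 2 Q + 1) := by
  have hqQ' : (q : ℝ) ≤ 2 * Q := by exact_mod_cast hqQ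
  have hQ' : (1 : ℝ) ≤ Q := by exact_mod_cast hQ
  have hq' : (1 : ℝ) ≤ q := by exact_mod_cast hq
  have h1 : Real.logb 2 q ≤ 1 + Real.logb 2 Q := by
    calc Real.logb 2 q ≤ Real.logb 2 (2 * Q) :=
          Real.logb_le_logb_of_le one_lt_two (by linarith) hqQ'
      _ = _ := by rw [Real.logb_mul (by norm_num) (by linarith), Real.logb_self_eq_one one_lt_two]
  have h0 : 0 ≤ Real.logb 2 q := Real.logb_nonneg one_lt_two hq'
  have h2 : (q : ℝ) * Real.logb 2 q ≤ 2 * Q * (1 + Real.logb 2 Q) :=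
    mul_le_mul hqQ' h1 h0 (by linarith)
  rcases Nat.lt_or_ge Q 2 with h | h
  · obtain rfl : Q = 1 := by omega
    have h4 : (q : ℝ) ≤ 2 := by exact_mod_cast hqQ
    norm_num at h2 ⊢
    linarith
  · have h3 : 1 ≤ Real.logb 2 Q := by
      rw [← Real.logb_self_eq_one one_lt_two]
      exact Real.logb_le_logb_of_le one_lt_two two_pos (by exact_mod_cast h)
    nlinarith

end Tradeoff

end QTradeoff

theorem mainTheorem9 :
    ∃ C : ℝ, ∀ (X : Type*) [Fintype X] (q : ℕ), 0 < q →
      (q : ℝ) ≤ Real.logb 2 (Fintype.card X) →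
      ∃ (Y : Type) (_ : Fintype Y) (_ : DecidableEq Y) (f : X → Y → ZMod 2) (Q K : ℕ),
        QTradeoff.Qoip (1 / 3) f = Q ∧ QTradeoff.Qcc (1 / 3) f = K ∧
        (q : ℝ) / 2 ≤ Q ∧ Q ≤ q ∧
        (Q : ℝ) * K ≤ 1 / 2 * Real.logb 2 (Fintype.card X) + C * (Q * Real.logb 2 Q + 1) := by
  classical
  refine ⟨8, fun X _ q hq hqX => ?_⟩
  set n : ℝ := Real.logb 2 (Fintype.card X) with hn
  have hq' : (0 : ℝ) < q := by exact_mod_cast hq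
  have hcard : 0 < Fintype.card X := by
    -- For empty X the convention log 0 = 0 contradicts 0 < q.
    rcases Nat.eq_zero_or_pos (Fintype.card X) with h | h
    · rw [hn, h, Nat.cast_zero, Real.logb_zero] at hqX; linarith
    · exact h
  have : Nonempty X := Fintype.card_pos_iff.mp hcard
  have : NeZero q := ⟨hq.ne'⟩
  have hcard' : (0 : ℝ) < Fintype.card X := by exact_mod_cast hcard
  -- The least k for which q blocks of 2k bits have room for log |X| bits.
  set k : ℕ := ⌈n / (2 * q)⌉₊ with hk
  have hnq : 0 < n / (2 * q) := div_pos (by linarith) (by linarith)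
  have hk0 : 0 < k := Nat.ceil_pos.mpr hnq
  have hk1 : n ≤ k * (2 * q) := (div_le_iff₀ (by linarith)).mp (Nat.le_ceil _)
  have hk2 : (k : ℝ) ≤ n / (2 * q) + 1 := (Nat.ceil_lt_add_one hnq.le).le
  have hlow : 2 ^ q ≤ Fintype.card X := by
    have := (Real.le_logb_iff_rpow_le one_lt_two hcard').mp hqX
    rw [Real.rpow_natCast] at this
    exact_mod_cast this
  have hupp : Fintype.card X ≤ (2 ^ (k + k)) ^ q := by
    have h1 : n ≤ ((k + k) * q : ℕ) := by push_cast; linarith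
    have := (Real.logb_le_iff_le_rpow one_lt_two hcard').mp h1
    rw [Real.rpow_natCast, pow_mul] at this
    exact_mod_cast this
  let j₀ : Fin k ⊕ Fin k := Sum.inl ⟨0, hk0⟩
  obtain ⟨e, he, hcube⟩ := QTradeoff.exists_injective_of_card_le (X := X)
    (g := fun (c : Fin q → Bool) i => QTradeoff.singleBit j₀ (c i))
    (fun c c' h => by
      funext i
      simpa [QTradeoff.singleBit] using congrFun (congrFun h i) j₀)
    (by simpa using hlow) (by simpa using hupp)
  have hQle := QTradeoff.Qoip_blockDot_le he
  have hKle := QTradeoff.Qcc_blockDot_le hq e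
  obtain ⟨Q, hQ⟩ := ENat.ne_top_iff_exists.mp (ne_top_of_le_ne_top (ENat.natCast_ne_top q) hQle)
  obtain ⟨K, hK⟩ := ENat.ne_top_iff_exists.mp (ne_top_of_le_ne_top (ENat.natCast_ne_top _) hKle)
  have hqQ := QTradeoff.le_two_mul_of_Qoip_blockDot_eq j₀ hcube hQ.symm
  rw [← hQ] at hQle
  rw [← hK] at hKle
  have hQq : Q ≤ q := by exact_mod_cast hQle
  have hKk : K ≤ Nat.clog 2 q + k := by exact_mod_cast hKle
  refine ⟨_, inferInstance, inferInstance, fun x => QTradeoff.blockDot (e x), Q, K, ?_, hK.symm,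
    ?_, hQq, ?_⟩
  · exact hQ.symm
  · have : (q : ℝ) ≤ 2 * Q := by exact_mod_cast hqQ
    linarith
  have hclog : (Nat.clog 2 q : ℝ) ≤ Real.logb 2 q + 1 := by
    have h := (Int.ceil_lt_add_one (Real.logb (2 : ℕ) q)).le
    rw [Real.ceil_logb_natCast (by positivity), Int.clog_natCast] at h
    exact_mod_cast h
  have hK' : (K : ℝ) ≤ (Real.logb 2 q + 1) + (n / (2 * q) + 1) := by
    have : (K : ℝ) ≤ Nat.clog 2 q + k := by exact_mod_cast hKk
    linarith
  have hnum := QTradeoff.mul_logb_two_add_le (Q := Q) (by omega) hqQ hq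
  -- The two extra units come from rounding log q and n/(2q) up to integers.
  calc (Q : ℝ) * K ≤ q * ((Real.logb 2 q + 1) + (n / (2 * q) + 1)) :=
        mul_le_mul (by exact_mod_cast hQq) hK' (by positivity) hq'.le
    _ = 1 / 2 * n + (q * Real.logb 2 q + 2 * q) := by field_simp; ring
    _ ≤ _ := by linarith
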